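/- Let $\alpha$ be an infinite cardinal. A topological space $X$ is called \emph{$\alpha$-pseudocompact} if $f(X)$ is compact for every continuous function $f\colon X\to\mathbb{R}^\alpha$. For an abelian group $A$ let $r_0(A)$ denote its free rank, i.e. the maximal cardinality of a $\mathbb{Z}$-linearly independent subset of $A$. An $\alpha$-pseudocompact abelian topological group $G$ is called \emph{$c_\alpha$-extremal} if $r_0(G/D)<2^\alpha$ for every dense subgroup $D$ of $G$ that is $\alpha$-pseudocompact in the subspace topology. \textbf{Theorem.} Let $\alpha$ be an infinite cardinal and let $G$ be a Hausdorff $\alpha$-pseudocompact abelian topological group. If $G$ is $c_\alpha$-extremal, then $r_0(G)\leq 2^\alpha$. -/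

import Mathlib

universe u v

/-- A topological space `X` is `α`-pseudocompact if the image of every continuous map
`X → ℝ^α` is compact; here `ℝ^α` is the product (with the product topology) of copies of `ℝ`
indexed by a set of cardinality `α`. -/
def IsAlphaPseudocompact (α : Cardinal.{v}) (X : Type u) [TopologicalSpace X] : Prop :=
  ∀ f : X → (α.out → ℝ), Continuous f → IsCompact (Set.range f)

/-- The free rank `r₀(G)` of an abelian group `G`: the largest cardinality of a
`ℤ`-linearly independent subset of `G`. -/
noncomputable def freeRank (G : Type u) [AddCommGroup G] : Cardinal.{u} :=
  Module.rank ℤ G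

/-- A topological abelian group `G` is `c_α`-extremal if it is `α`-pseudocompact and
`r₀(G/D) < 2^α` for every dense subgroup `D` of `G` that is `α`-pseudocompact in the subspace
topology. -/
structure IsCExtremal (α : Cardinal.{u}) (G : Type u) [AddCommGroup G] [TopologicalSpace G] :
    Prop where
  alphaPseudocompact : IsAlphaPseudocompact α G
  freeRank_quotient_lt : ∀ D : AddSubgroup G, Dense (D : Set G) → IsAlphaPseudocompact α D →
    freeRank (G ⧸ D) < 2 ^ α

open Set Filter Topology Cardinal MeasureTheory

/-! If r₀(G) > 2^α, split a maximal independent set into countably many blocks of full size. This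
covers G by subgroups A_n with r₀(G/A_n) ≥ r₀(G). A Baire argument
(`IsAlphaPseudocompact.exists_isFiberDense`) makes some A_n fibre-dense in a fibre subgroup N. Total
boundedness gives |G/N| ≤ 2^α, so adjoining coset representatives of N to A_n costs rank at most 2^α
and yields D fibre-dense in G. Real continuous functions on D extend to G
(`IsFiberDense.exists_continuous_extension`), hence D is α-pseudocompact. Extremality then forces
r₀(G/A_n) ≤ r₀(G/D) + 2^α ≤ 2^α, a contradiction. -/

/-- `A` meets every nonempty set of the form `N ∩ f ⁻¹' {p}`, where `f : X → ℝ^α` is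
continuous. -/
def IsFiberDense (α : Cardinal.{v}) {X : Type u} [TopologicalSpace X] (A N : Set X) : Prop :=
  ∀ f : X → (α.out → ℝ), Continuous f → ∀ x ∈ N, ∃ a ∈ A, a ∈ N ∧ f a = f x

/-- The subgroup `N` is the fibre through `0` of some continuous map `G → ℝ^α`. -/
def IsFiberSubgroup (α : Cardinal.{v}) {G : Type u} [AddCommGroup G] [TopologicalSpace G]
    (N : AddSubgroup G) : Prop :=
  ∃ f : G → (α.out → ℝ), Continuous f ∧ ∀ x, x ∈ N ↔ f x = f 0

theorem exists_continuous_fiber_eq {α : Cardinal.{u}} {X : Type v} [TopologicalSpace X]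
    {ι : Type u} [Nonempty ι] (hι : #ι ≤ α) (g : ι → X → ℝ) (hg : ∀ i, Continuous (g i)) :
    ∃ f : X → (α.out → ℝ), Continuous f ∧ ∀ x y, f x = f y ↔ ∀ i, g i x = g i y := by
  rw [← mk_out α] at hι
  obtain ⟨e⟩ := hι
  refine ⟨fun x a => g (Function.invFun e a) x, continuous_pi fun a => hg _, fun x y => ?_⟩
  refine ⟨fun h i => ?_, fun h => funext fun a => h _⟩
  simpa [Function.leftInverse_invFun e.injective i] using congrFun h (e i)

theorem mk_out_prod_nat_le {α : Cardinal.{u}} (hα : ℵ₀ ≤ α) : #(α.out × ℕ) ≤ α := by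
  simp [mul_aleph0_eq hα]

theorem IsFiberDense.exists_forall_eq {α : Cardinal.{u}} {X : Type v} [TopologicalSpace X]
    {A N : Set X} (h : IsFiberDense α A N) {ι : Type u} [Nonempty ι] (hι : #ι ≤ α)
    (g : ι → X → ℝ) (hg : ∀ i, Continuous (g i)) {x : X} (hx : x ∈ N) :
    ∃ a ∈ A, a ∈ N ∧ ∀ i, g i a = g i x := by
  obtain ⟨f, hf, hfg⟩ := exists_continuous_fiber_eq hι g hg
  obtain ⟨a, ha, haN, hax⟩ := h f hf x hx
  exact ⟨a, ha, haN, (hfg _ _).1 hax⟩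

/-! ### Fibre subgroups, total boundedness and the countable chain condition -/

section

variable {G : Type u} [AddCommGroup G] [TopologicalSpace G] [IsTopologicalAddGroup G]

theorem exists_continuous_eq_zero_of_mem_nhds {x : G} {U : Set G} (hU : U ∈ 𝓝 x) :
    ∃ f : G → ℝ, Continuous f ∧ f x = 0 ∧ ∀ y ∉ U, f y = 1 := by
  let := IsTopologicalAddGroup.rightUniformSpace G
  obtain ⟨V, hVU, hV, hxV⟩ := mem_nhds_iff.1 hU
  obtain ⟨f, hf, hfx, hfV⟩ := CompletelyRegularSpace.completely_regular_isOpen x V hV hxV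
  refine ⟨fun y => (f y : ℝ), by fun_prop, by simp [hfx], fun y hy => ?_⟩
  simp [hfV (show y ∈ Vᶜ from fun h => hy (hVU h))]

theorem exists_sub_mem_of_mem_nhds_zero {U : Set G} (hU : U ∈ 𝓝 (0 : G)) :
    ∃ V ∈ 𝓝 (0 : G), ∀ x ∈ V, ∀ y ∈ V, x - y ∈ U := by
  have h : Tendsto (fun p : G × G => p.1 - p.2) (𝓝 0 ×ˢ 𝓝 0) (𝓝 0) := by
    have : Continuous (fun p : G × G => p.1 - p.2) := by fun_prop
    simpa [nhds_prod_eq] using this.tendsto (0, 0)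
  obtain ⟨V, hV, hVU⟩ := mem_prod_same_iff.1 (h hU)
  exact ⟨V, hV, fun x hx y hy => hVU (mk_mem_prod hx hy)⟩

theorem setOf_sub_mem_mem_nhds {U : Set G} (hU : U ∈ 𝓝 (0 : G)) (x : G) :
    {y | y - x ∈ U} ∈ 𝓝 x := by
  have : Continuous (fun y : G => y - x) := by fun_prop
  exact this.continuousAt (by simpa using hU)

theorem setOf_add_mem_mem_nhds_zero {x : G} {U : Set G} (hU : U ∈ 𝓝 x) :
    {y | x + y ∈ U} ∈ 𝓝 (0 : G) := by
  have : Continuous (fun y : G => x + y) := by fun_prop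
  exact this.continuousAt (by simpa using hU)

theorem exists_continuous_eq_zero_on_nhds_zero {U : Set G} (hU : U ∈ 𝓝 (0 : G)) :
    ∃ f : G → ℝ, ∃ V ∈ 𝓝 (0 : G), Continuous f ∧ (∀ x ∈ V, f x = 0) ∧ (∀ x, f x = 0 → x ∈ U) ∧
      ∀ x ∈ V, ∀ y ∈ V, x - y ∈ U := by
  obtain ⟨f, hf, hf0, hfU⟩ := exists_continuous_eq_zero_of_mem_nhds hU
  obtain ⟨V, hV, hVU⟩ := exists_sub_mem_of_mem_nhds_zero hU
  -- Truncating at 1/2 makes the function vanish on a whole neighbourhood, while its zero set stays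
  -- inside U.
  refine ⟨fun x => max (f x - 1 / 2) 0, V ∩ {x | f x < 1 / 2}, inter_mem hV ?_, by fun_prop,
    fun x hx => max_eq_right ?_, fun x hx => ?_, fun x hx y hy => hVU x hx.1 y hy.1⟩
  · exact hf.continuousAt.eventually_lt continuousAt_const (by simp [hf0])
  · have := hx.2
    simp only [mem_ofPred_eq] at this
    linarith
  · by_contra h
    norm_num [hfU x h] at hx

/-- Iterate W ↦ V(W) from each U i. Since V − V ⊆ W, the intersection of all iterates is a subgroup;
since V ⊆ {φ_W = 0} ⊆ W, it is also the common zero set of at most α functions. -/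
theorem exists_isFiberSubgroup_subset {α : Cardinal.{u}} (hα : ℵ₀ ≤ α) {ι : Type u} [Nonempty ι]
    (hι : #ι ≤ α) (U : ι → Set G) (hU : ∀ i, U i ∈ 𝓝 (0 : G)) :
    ∃ N : AddSubgroup G, IsFiberSubgroup α N ∧ ∀ i, (N : Set G) ⊆ U i := by
  choose φ V hV hφ hφV hφU hVU using
    fun W : {W : Set G // W ∈ 𝓝 (0 : G)} => exists_continuous_eq_zero_on_nhds_zero W.2
  let W : ι → ℕ → {W : Set G // W ∈ 𝓝 (0 : G)} := fun i n =>
    (fun W => ⟨V W, hV W⟩)^[n] ⟨U i, hU i⟩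
  have hW : ∀ i n, (W i (n + 1) : Set G) = V (W i n) := fun i n => by
    simp only [W, Function.iterate_succ_apply']
  have hsub : ∀ i n x y, x ∈ (W i (n + 1) : Set G) → y ∈ (W i (n + 1) : Set G) →
      x - y ∈ (W i n : Set G) := fun i n x y hx hy => by
    rw [hW] at hx hy
    exact hVU _ _ hx _ hy
  have hneg : ∀ x, (∀ i n, x ∈ (W i n : Set G)) → ∀ i n, -x ∈ (W i n : Set G) :=
    fun x hx i n => by
      simpa using hsub i n 0 x (mem_of_mem_nhds (W i (n + 1)).2) (hx _ _)
  let N : AddSubgroup G :=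
    { carrier := {x | ∀ i n, x ∈ (W i n : Set G)}
      zero_mem' := fun i n => mem_of_mem_nhds (W i n).2
      neg_mem' := fun {x} hx => hneg x hx
      add_mem' := fun {x y} hx hy i n => by
        simpa using hsub i n x (-y) (hx _ _) (hneg y hy _ _) }
  have hcard : #(ι × ℕ) ≤ α := by
    simpa using (mul_le_mul' hι le_rfl).trans (mul_aleph0_eq hα).le
  obtain ⟨f, hf, hfφ⟩ := exists_continuous_fiber_eq hcard
    (fun p : ι × ℕ => φ (W p.1 p.2)) (fun p => hφ _)
  refine ⟨N, ⟨f, hf, fun x => ?_⟩, fun i x hx => hx i 0⟩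
  rw [hfφ]
  have h0 : ∀ w, φ w 0 = 0 := fun w => hφV w 0 (mem_of_mem_nhds (hV w))
  refine ⟨fun hx p => ?_, fun hx i n => ?_⟩
  · rw [h0]
    refine hφV _ _ ?_
    rw [← hW]
    exact hx _ _
  · refine hφU _ _ ?_
    rw [hx (i, n), h0]

theorem exists_isFiberSubgroup_forall_eq {α : Cardinal.{u}} (hα : ℵ₀ ≤ α) {f : G → (α.out → ℝ)}
    (hf : Continuous f) :
    ∃ N : AddSubgroup G, IsFiberSubgroup α N ∧ ∀ x ∈ N, f x = f 0 := by
  have hne : Nonempty α.out := by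
    rw [← mk_ne_zero_iff, mk_out]
    exact (aleph0_pos.trans_le hα).ne'
  obtain ⟨N, hN, hNU⟩ := exists_isFiberSubgroup_subset hα (mk_out_prod_nat_le hα)
    (fun p : α.out × ℕ => {x : G | |f x p.1 - f 0 p.1| < 1 / ((p.2 : ℝ) + 1)}) (fun p => by
      have : Continuous fun x => |f x p.1 - f 0 p.1| := by fun_prop
      exact this.continuousAt.eventually_lt continuousAt_const (by simp; positivity))
  refine ⟨N, hN, fun x hx => funext fun a => ?_⟩
  by_contra h
  obtain ⟨n, hn⟩ := exists_nat_one_div_lt (abs_pos.2 (sub_ne_zero.2 h))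
  exact lt_asymm hn (hNU (a, n) hx)

omit [IsTopologicalAddGroup G] in
theorem IsFiberSubgroup.inf {α : Cardinal.{u}} (hα : ℵ₀ ≤ α) {M N : AddSubgroup G}
    (hM : IsFiberSubgroup α M) (hN : IsFiberSubgroup α N) : IsFiberSubgroup α (M ⊓ N) := by
  have hne : Nonempty α.out := by
    rw [← mk_ne_zero_iff, mk_out]
    exact (aleph0_pos.trans_le hα).ne'
  obtain ⟨f, hf, hfM⟩ := hM
  obtain ⟨g, hg, hgN⟩ := hN
  obtain ⟨k, hk, hkfg⟩ := exists_continuous_fiber_eq (α := α) (ι := α.out ⊕ α.out)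
    (by simp [add_eq_self hα]) (Sum.elim (fun a x => f x a) (fun a x => g x a))
    (by rintro (a | a) <;> simp <;> fun_prop)
  refine ⟨k, hk, fun x => ?_⟩
  rw [AddSubgroup.mem_inf, hfM, hgN, hkfg]
  simp [funext_iff]

/-- Without total boundedness there is a uniformly separated sequence; bumps of height n at its n-th
point sum to an unbounded continuous function. -/
theorem IsAlphaPseudocompact.exists_finset_sub_mem {α : Cardinal.{v}} (hα : ℵ₀ ≤ α)
    (hG : IsAlphaPseudocompact α G) {U : Set G} (hU : U ∈ 𝓝 (0 : G)) :
    ∃ F : Finset G, ∀ x, ∃ y ∈ F, x - y ∈ U := by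
  by_contra! hF
  obtain ⟨x, -, hx⟩ := exists_seq_of_forall_finset_exists (fun _ : G => True)
    (fun y x => x - y ∉ U) (fun s _ => (hF s).imp fun y hy => ⟨trivial, hy⟩)
  obtain ⟨V, hV, hVU⟩ := exists_sub_mem_of_mem_nhds_zero hU
  obtain ⟨W, hW, hWV⟩ := exists_sub_mem_of_mem_nhds_zero hV
  obtain ⟨φ, hφ, hφ0, hφW⟩ := exists_continuous_eq_zero_of_mem_nhds hW
  have key : ∀ m n, m < n → ∀ y z, y - x m ∈ W → y - z ∈ W → ∀ y', y' - x n ∈ W →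
      y' - z ∈ W → False := by
    intro m n hmn y z h1 h2 y' h3 h4
    refine hx m n hmn ?_
    have := hVU _ (hWV _ h4 _ h3) _ (hWV _ h2 _ h1)
    have e : y' - z - (y' - x n) - (y - z - (y - x m)) = x n - x m := by abel
    rwa [e] at this
  let g : ℕ → G → ℝ := fun n y => n * (1 - φ (y - x n))
  have hg : ∀ n y, g n y ≠ 0 → y - x n ∈ W := fun n y h => by
    by_contra hy
    exact h (by simp [g, hφW _ hy])
  have huniq : ∀ z y y' m n, y - z ∈ W → y' - z ∈ W → g m y ≠ 0 → g n y' ≠ 0 → m = n := by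
    intro z y y' m n h1 h2 h3 h4
    rcases lt_trichotomy m n with h | h | h
    · exact (key m n h y z (hg _ _ h3) h1 y' (hg _ _ h4) h2).elim
    · exact h
    · exact (key n m h y' z (hg _ _ h4) h2 y (hg _ _ h3) h1).elim
  have hcont : Continuous fun y => ∑ᶠ n, g n y := by
    refine continuous_finsum (fun n => by fun_prop) fun z => ?_
    refine ⟨{y | y - z ∈ W}, setOf_sub_mem_mem_nhds hW z, Set.Subsingleton.finite ?_⟩
    rintro m ⟨y, hy, hyz⟩ n ⟨y', hy', hyz'⟩
    exact huniq z y y' m n hyz hyz' hy hy'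
  have hval : ∀ n : ℕ, ∑ᶠ k, g k (x n) = n := fun n => by
    have h0 : (0 : G) ∈ W := mem_of_mem_nhds hW
    rw [finsum_eq_single _ n]
    · simp [g, hφ0]
    · intro m hm
      by_contra h
      -- `g 0` vanishes identically, so `huniq` says nothing at index 0 and `key` is used directly.
      rcases Nat.eq_zero_or_pos n with rfl | hn
      · rcases Nat.eq_zero_or_pos m with rfl | hm'
        · exact hm rfl
        · exact key 0 m hm' (x 0) (x 0) (by simpa) (by simpa) (x 0) (hg _ _ h)
            (by simpa)
      · refine hm (huniq (x n) (x n) (x n) m n (by simpa) (by simpa) h ?_)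
        simp [g, hφ0, hn.ne']
  have hne : Nonempty α.out := by
    rw [← mk_ne_zero_iff, mk_out]
    exact (aleph0_pos.trans_le hα).ne'
  obtain ⟨a⟩ := hne
  have hc := (hG (fun y _ => ∑ᶠ n, g n y) (continuous_pi fun _ => hcont)).image
    (continuous_apply a)
  obtain ⟨B, hB⟩ := hc.bddAbove
  obtain ⟨n, hn⟩ := exists_nat_gt B
  have := hB ⟨_, ⟨x n, rfl⟩, rfl⟩
  simp only [hval] at this
  linarith

/-- The completion is a compact group; its Haar measure is finite and positive on nonempty open
sets. -/
theorem countable_of_pairwise_disjoint_isOpen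
    (hG : ∀ U ∈ 𝓝 (0 : G), ∃ F : Finset G, ∀ x, ∃ y ∈ F, x - y ∈ U)
    {ι : Type v} (O : ι → Set G) (hO : ∀ i, IsOpen (O i)) (hne : ∀ i, (O i).Nonempty)
    (hd : Pairwise fun i j => Disjoint (O i) (O j)) : Countable ι := by
  let := IsTopologicalAddGroup.rightUniformSpace G
  have : IsUniformAddGroup G := isUniformAddGroup_of_addCommGroup
  have htb : TotallyBounded (univ : Set G) := by
    rw [totallyBounded_iff_subset_finite_iUnion_nhds_zero]
    intro U hU
    obtain ⟨F, hF⟩ := hG U hU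
    refine ⟨F, F.finite_toSet, fun x _ => ?_⟩
    obtain ⟨y, hy, hyU⟩ := hF x
    simp only [mem_iUnion]
    exact ⟨y, hy, x - y, hyU, by simp⟩
  let K := UniformSpace.Completion G
  have hcK : CompactSpace K := by
    refine ⟨?_⟩
    rw [isCompact_iff_totallyBounded_isComplete]
    refine ⟨?_, completeSpace_iff_isComplete_univ.1 inferInstance⟩
    have := (htb.image (UniformSpace.Completion.uniformContinuous_coe G)).closure
    rwa [image_univ, UniformSpace.Completion.denseRange_coe.closure_range] at this
  let : MeasurableSpace K := borel K
  have : BorelSpace K := ⟨rfl⟩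
  let μ : Measure K := Measure.addHaarMeasure ⊤
  have hO' : ∀ i, ∃ P : Set K, IsOpen P ∧ ((↑) : G → K) ⁻¹' P = O i := fun i =>
    (UniformSpace.Completion.isUniformInducing_coe G).isInducing.isOpen_iff.1 (hO i)
  choose P hP hPO using hO'
  have hPd : Pairwise fun i j => Disjoint (P i) (P j) := by
    intro i j hij
    rw [Set.disjoint_iff_inter_eq_empty]
    by_contra h
    obtain ⟨x, hx⟩ := UniformSpace.Completion.denseRange_coe.exists_mem_open
      ((hP i).inter (hP j)) (nonempty_iff_ne_empty.2 h)
    have hxi : x ∈ O i := by rw [← hPO]; exact hx.1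
    have hxj : x ∈ O j := by rw [← hPO]; exact hx.2
    exact Set.disjoint_left.1 (hd hij) hxi hxj
  have hc := Measure.countable_meas_pos_of_disjoint_iUnion (μ := μ)
    (fun i => (hP i).measurableSet) hPd
  have : {i | 0 < μ (P i)} = Set.univ := by
    refine eq_univ_of_forall fun i => (hP i).measure_pos μ ?_
    obtain ⟨x, hx⟩ := hne i
    rw [← hPO] at hx
    exact ⟨_, hx⟩
  rw [this] at hc
  exact countable_univ_iff.1 hc

/-- A maximal disjoint family of nonempty open sets satisfying P is countable, and maximality makes
its union dense. -/
theorem exists_countable_forall_isOpen_inter_nonempty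
    (hG : ∀ U ∈ 𝓝 (0 : G), ∃ F : Finset G, ∀ x, ∃ y ∈ F, x - y ∈ U) (P : Set G → Prop)
    (hP : ∀ V, IsOpen V → V.Nonempty → ∃ O ⊆ V, IsOpen O ∧ O.Nonempty ∧ P O) :
    ∃ c : Set (Set G), c.Countable ∧ (∀ O ∈ c, IsOpen O ∧ P O) ∧
      ∀ V, IsOpen V → V.Nonempty → ∃ O ∈ c, (V ∩ O).Nonempty := by
  obtain ⟨c, hc⟩ := zorn_subset
    {c : Set (Set G) | c.PairwiseDisjoint id ∧ ∀ O ∈ c, IsOpen O ∧ O.Nonempty ∧ P O} (by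
      intro t ht hchain
      refine ⟨⋃₀ t, ⟨?_, ?_⟩, fun s hs => subset_sUnion_of_mem hs⟩
      · exact (pairwiseDisjoint_sUnion hchain.directedOn).2 fun s hs => (ht hs).1
      · rintro O ⟨s, hs, hO⟩
        exact (ht hs).2 O hO)
  have hcc : c.Countable := countable_of_pairwise_disjoint_isOpen hG (fun i : c => (i : Set G))
    (fun i => (hc.prop.2 i i.2).1) (fun i => (hc.prop.2 i i.2).2.1)
    (fun i j hij => hc.prop.1 i.2 j.2 (Subtype.coe_injective.ne hij))
  refine ⟨c, hcc, fun O hO => ⟨(hc.prop.2 O hO).1, (hc.prop.2 O hO).2.2⟩, fun V hV hVne => ?_⟩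
  obtain ⟨O, hOV, hO, ⟨x, hx⟩, hPO⟩ := hP V hV hVne
  by_contra! h
  have hOc : O ∈ c := by
    refine hc.le_of_ge (y := insert O c) ⟨?_, ?_⟩ (subset_insert O c) (mem_insert O c)
    · refine hc.prop.1.insert fun Q hQ _ => ?_
      exact (Set.disjoint_iff_inter_eq_empty.2 (h Q hQ)).mono_left hOV
    · rintro Q (rfl | hQ)
      · exact ⟨hO, ⟨x, hx⟩, hPO⟩
      · exact hc.prop.2 Q hQ
  have := h O hOc
  exact (this ▸ ⟨hOV hx, hx⟩ : x ∈ (∅ : Set G))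

end

/-! ### Extending continuous functions from fibre-dense subgroups -/

section

variable {G : Type u} [AddCommGroup G] [TopologicalSpace G] [IsTopologicalAddGroup G]

theorem IsFiberDense.exists_mem_inter {α : Cardinal.{u}} (hα : ℵ₀ ≤ α) {D : Set G}
    (hD : IsFiberDense α D univ) {N : AddSubgroup G} (hN : IsFiberSubgroup α N) (x : G) {U : Set G}
    (hU : U ∈ 𝓝 x) : ∃ d ∈ D, d ∈ U ∧ d - x ∈ N := by
  obtain ⟨f, hf, hfN⟩ := hN
  obtain ⟨φ, hφ, hφx, hφU⟩ := exists_continuous_eq_zero_of_mem_nhds hU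
  obtain ⟨d, hd, -, hdx⟩ := hD.exists_forall_eq (ι := Option α.out)
    (by simp [add_one_eq hα]) (fun o => o.elim φ fun a y => f (y - x) a)
    (by rintro (_ | a) <;> simp <;> fun_prop) (mem_univ x)
  refine ⟨d, hd, ?_, ?_⟩
  · by_contra h
    have := hdx none
    simp [hφx, hφU d h] at this
  · rw [hfN]
    funext a
    simpa using hdx (some a)

theorem IsFiberDense.exists_mem_nhds {α : Cardinal.{u}} (hα : ℵ₀ ≤ α) {D : Set G}
    (hD : IsFiberDense α D univ) {x : G} {U : Set G} (hU : U ∈ 𝓝 x) : ∃ d ∈ D, d ∈ U := by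
  obtain ⟨φ, hφ, hφx, hφU⟩ := exists_continuous_eq_zero_of_mem_nhds hU
  obtain ⟨d, hd, -, hdx⟩ := hD.exists_forall_eq (ι := PUnit)
    (by simpa using one_le_aleph0.trans hα) (fun _ => φ) (fun _ => hφ) (mem_univ x)
  refine ⟨d, hd, ?_⟩
  by_contra h
  have := hdx ⟨⟩
  simp [hφx, hφU d h] at this

/-- For each n, countably many open sets with dense union carry a modulus of continuity for 1/(n+1).
Take N inside all these countably many neighbourhoods. To compare f at d and d', shift both slightly
by the same element so that d lands in one of the open sets. -/
theorem IsFiberDense.exists_isFiberSubgroup_forall_eq {α : Cardinal.{u}} (hα : ℵ₀ ≤ α)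
    (hG : ∀ U ∈ 𝓝 (0 : G), ∃ F : Finset G, ∀ x, ∃ y ∈ F, x - y ∈ U) {D : AddSubgroup G}
    (hD : IsFiberDense α (D : Set G) univ) {f : D → ℝ} (hf : Continuous f) :
    ∃ N : AddSubgroup G, IsFiberSubgroup α N ∧ ∀ d d' : D, (d' : G) - d ∈ N → f d' = f d := by
  have hcont : ∀ d : D, ∀ ε > 0, ∃ W ∈ 𝓝 (0 : G), ∀ d' : D, (d' : G) - d ∈ W →
      |f d' - f d| < ε := fun d ε hε => by
    have h := hf.continuousAt.eventually (Metric.ball_mem_nhds (f d) hε)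
    rw [Filter.Eventually, nhds_subtype_eq_comap, mem_comap] at h
    obtain ⟨t, ht, hts⟩ := h
    refine ⟨_, setOf_add_mem_mem_nhds_zero ht, fun d' hd' => ?_⟩
    have : (d' : G) ∈ t := by simpa using hd'
    exact hts this
  have hsmall : ∀ n : ℕ, ∃ c : Set (Set G), c.Countable ∧ (∀ O ∈ c, IsOpen O ∧
      ∃ U ∈ 𝓝 (0 : G), ∀ d d' : D, (d : G) ∈ O → (d' : G) - d ∈ U →
        |f d' - f d| < 1 / ((n : ℝ) + 1)) ∧
      ∀ V, IsOpen V → V.Nonempty → ∃ O ∈ c, (V ∩ O).Nonempty := fun n => by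
    refine exists_countable_forall_isOpen_inter_nonempty hG _ fun V hV ⟨x, hx⟩ => ?_
    obtain ⟨d, hd, hdV⟩ := hD.exists_mem_nhds hα (hV.mem_nhds hx)
    obtain ⟨W, hW, hWf⟩ := hcont ⟨d, hd⟩ (1 / ((n : ℝ) + 1) / 2) (by positivity)
    obtain ⟨U, hU, hUW⟩ := exists_sub_mem_of_mem_nhds_zero hW
    have h0 := mem_of_mem_nhds hU
    refine ⟨V ∩ interior {y | y - d ∈ U ∩ -U}, inter_subset_left,
      hV.inter isOpen_interior, ⟨d, hdV, ?_⟩, U ∩ -U, inter_mem hU (neg_mem_nhds_zero G hU), ?_⟩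
    · exact mem_interior_iff_mem_nhds.2
        (setOf_sub_mem_mem_nhds (inter_mem hU (neg_mem_nhds_zero G hU)) d)
    · intro e e' he he'
      have he2 := interior_subset he.2
      have h1 := hWf e (by simpa using hUW _ he2.1 0 h0)
      have h2 := hWf e' (by
        have := hUW _ he'.1 _ he2.2
        have e0 : (e' : G) - e - -(e - d) = e' - d := by abel
        rwa [e0] at this)
      rw [abs_lt] at h1 h2 ⊢
      constructor <;> linarith [h1.1, h1.2, h2.1, h2.2]
  choose c hc hcO hcV using hsmall
  choose hO U hU hUf using hcO
  -- `none` only keeps the index type nonempty.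
  have hcount : #(Option (Σ n, c n)) ≤ α := by
    have : ∀ n, Countable (c n) := fun n => (hc n).to_subtype
    exact mk_le_aleph0.trans hα
  obtain ⟨N, hN, hNU⟩ := exists_isFiberSubgroup_subset hα hcount
    (fun o => o.elim Set.univ fun p => U p.1 p.2 p.2.2) (by
      rintro (_ | p)
      · exact univ_mem
      · exact hU _ _ _)
  refine ⟨N, hN, fun d d' hdd' => ?_⟩
  by_contra hne
  have hpos := abs_pos.2 (sub_ne_zero.2 hne)
  -- Three errors of a quarter of |f d' − f d| each will sum to less than the whole.
  obtain ⟨n, hn⟩ := exists_nat_one_div_lt (half_pos (half_pos hpos))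
  obtain ⟨V, hV, hVf⟩ := hcont d _ (half_pos (half_pos hpos))
  obtain ⟨V', hV', hVf'⟩ := hcont d' _ (half_pos (half_pos hpos))
  obtain ⟨O, hOc, y, hyV, hyO⟩ := hcV n (interior {y | y - (d : G) ∈ V ∩ V'}) isOpen_interior
    ⟨d, mem_interior_iff_mem_nhds.2 (setOf_sub_mem_mem_nhds (inter_mem hV hV') _)⟩
  obtain ⟨e, heD, heV, heO⟩ := hD.exists_mem_nhds hα
    ((isOpen_interior.inter (hO n O hOc)).mem_nhds ⟨hyV, hyO⟩)
  have heV := interior_subset heV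
  have h1 := hVf ⟨e, heD⟩ heV.1
  have h2 := hVf' (⟨e, heD⟩ + (d' - d)) (by
    have e0 : e + ((d' : G) - d) - d' = e - d := by abel
    simpa [e0] using heV.2)
  have h3 := hUf n O hOc ⟨e, heD⟩ (⟨e, heD⟩ + (d' - d)) heO (by
    simpa using hNU (some ⟨n, O, hOc⟩) hdd')
  have h4 : |f d' - f d| < |f d' - f d| := by
    calc |f d' - f d| = |(f (⟨e, heD⟩ + (d' - d)) - f ⟨e, heD⟩) + (f ⟨e, heD⟩ - f d)
          - (f (⟨e, heD⟩ + (d' - d)) - f d')| := by congr 1; ring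
      _ ≤ |f (⟨e, heD⟩ + (d' - d)) - f ⟨e, heD⟩| + |f ⟨e, heD⟩ - f d|
          + |f (⟨e, heD⟩ + (d' - d)) - f d'| :=
        (abs_sub _ _).trans (add_le_add_left (abs_add_le _ _) _)
      _ < |f d' - f d| := by linarith
  exact lt_irrefl _ h4

/-- As f is constant on traces of N-cosets, set g(x) = f(d) for any d ∈ D ∩ (x + N). Such d can be
found in any open set meeting x + N, which gives continuity. -/
theorem IsFiberDense.exists_continuous_extension {α : Cardinal.{u}} (hα : ℵ₀ ≤ α)
    (hG : ∀ U ∈ 𝓝 (0 : G), ∃ F : Finset G, ∀ x, ∃ y ∈ F, x - y ∈ U) {D : AddSubgroup G}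
    (hD : IsFiberDense α (D : Set G) univ) {f : D → ℝ} (hf : Continuous f) :
    ∃ g : G → ℝ, Continuous g ∧ ∀ d : D, g d = f d := by
  obtain ⟨N, hN, hNf⟩ := hD.exists_isFiberSubgroup_forall_eq hα hG hf
  have hr : ∀ x : G, ∃ d : D, (d : G) - x ∈ N := fun x => by
    obtain ⟨d, hd, -, hdN⟩ := hD.exists_mem_inter hα hN x univ_mem
    exact ⟨⟨d, hd⟩, hdN⟩
  choose r hr using hr
  have hrf : ∀ x (d : D), (d : G) - x ∈ N → f (r x) = f d := fun x d hd =>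
    hNf _ _ (by simpa using N.sub_mem (hr x) hd)
  refine ⟨fun x => f (r x), ?_, fun d => hrf _ _ (by simp)⟩
  rw [continuous_iff_continuousAt]
  intro x
  refine (nhds_basis_opens _).tendsto_right_iff.2 ?_
  rintro T ⟨hxT, hT⟩
  obtain ⟨S, hS, hST⟩ := isOpen_induced_iff.1 (hT.preimage hf)
  have hrS : (r x : G) ∈ S := by
    have : r x ∈ Subtype.val ⁻¹' S := by rw [hST]; exact hxT
    exact this
  have hnhds : {y | y - x + r x ∈ S} ∈ 𝓝 x := by
    have : Continuous fun y : G => y - x + r x := by fun_prop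
    exact this.continuousAt (hS.mem_nhds (by simpa using hrS))
  filter_upwards [hnhds] with y hy
  obtain ⟨d, hd, hdS, hdN⟩ := hD.exists_mem_inter hα hN (y - x + r x) (hS.mem_nhds hy)
  have h1 : d - y ∈ N := by
    have := N.add_mem hdN (hr x)
    have e : d - (y - x + r x) + (r x - x) = d - y := by abel
    rwa [e] at this
  rw [hrf y ⟨d, hd⟩ h1]
  have : (⟨d, hd⟩ : D) ∈ Subtype.val ⁻¹' S := hdS
  rw [hST] at this
  exact this

theorem IsFiberDense.isAlphaPseudocompact {α : Cardinal.{u}} (hα : ℵ₀ ≤ α)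
    (hG : IsAlphaPseudocompact α G) {D : AddSubgroup G}
    (hD : IsFiberDense α (D : Set G) univ) : IsAlphaPseudocompact α D := by
  intro f hf
  choose g hg hgf using fun a => hD.exists_continuous_extension hα
    (fun U hU => hG.exists_finset_sub_mem hα hU) ((continuous_apply a).comp hf)
  have hgc : Continuous fun x a => g a x := continuous_pi hg
  convert hG _ hgc using 1
  ext p
  constructor
  · rintro ⟨d, rfl⟩
    exact ⟨d, funext fun a => hgf a d⟩
  · rintro ⟨x, rfl⟩
    obtain ⟨d, hd, -, hdx⟩ := hD _ hgc x (mem_univ x)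
    exact ⟨⟨d, hd⟩, (funext fun a => (hgf a ⟨d, hd⟩).symm).trans hdx⟩

end

/-! ### Index of fibre subgroups and the Baire argument -/

section

variable {G : Type u} [AddCommGroup G] [TopologicalSpace G] [IsTopologicalAddGroup G]

/-- Finite nets for α · ℵ₀ neighbourhoods encode each coset injectively, giving at most ℵ₀^α = 2^α
cosets. -/
theorem IsFiberSubgroup.mk_quotient_le {α : Cardinal.{u}} (hα : ℵ₀ ≤ α)
    (hG : ∀ U ∈ 𝓝 (0 : G), ∃ F : Finset G, ∀ x, ∃ y ∈ F, x - y ∈ U) {N : AddSubgroup G}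
    (hN : IsFiberSubgroup α N) : #(G ⧸ N) ≤ 2 ^ α := by
  obtain ⟨f, hf, hfN⟩ := hN
  have hV : ∀ p : α.out × ℕ, ∃ V ∈ 𝓝 (0 : G), ∀ x ∈ V, ∀ y ∈ V,
      |f (x - y) p.1 - f 0 p.1| < 1 / ((p.2 : ℝ) + 1) := fun p =>
    exists_sub_mem_of_mem_nhds_zero (U := {x | |f x p.1 - f 0 p.1| < 1 / ((p.2 : ℝ) + 1)}) (by
      have : Continuous fun x => |f x p.1 - f 0 p.1| := by fun_prop
      exact this.continuousAt.eventually_lt continuousAt_const (by simp; positivity))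
  choose V hV hVf using hV
  choose F hF using fun p => hG _ (hV p)
  choose s hsF hsV using hF
  have hfin : ∀ p, Nonempty (F p ↪ ULift.{u} ℕ) := fun p =>
    ⟨(F p).equivFin.toEmbedding.trans (Fin.valEmbedding.trans Equiv.ulift.symm.toEmbedding)⟩
  let e := fun p => (hfin p).some
  have hinj : Function.Injective fun (q : G ⧸ N) (p : α.out × ℕ) =>
      e p ⟨s p q.out, hsF p q.out⟩ := by
    intro q q' h
    have hs : ∀ p, s p q.out = s p q'.out := fun p => by
      simpa using (e p).injective (congrFun h p)
    have hmem : q.out - q'.out ∈ N := by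
      rw [hfN]
      funext a
      by_contra hne
      obtain ⟨n, hn⟩ := exists_nat_one_div_lt (abs_pos.2 (sub_ne_zero.2 hne))
      have := hVf (a, n) _ (hsV (a, n) q.out) _ (hsV (a, n) q'.out)
      rw [hs, sub_sub_sub_cancel_right] at this
      exact lt_asymm hn this
    rw [← q.out_eq', ← q'.out_eq']
    refine QuotientAddGroup.eq.2 ?_
    have := N.neg_mem hmem
    simpa [sub_eq_add_neg, add_comm] using this
  calc #(G ⧸ N) ≤ #(α.out × ℕ → ULift.{u} ℕ) := mk_le_of_injective hinj
    _ = ℵ₀ ^ α := by simp [mul_aleph0_eq hα]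
    _ = 2 ^ α := power_eq_two_power hα natCast_le_aleph0 hα

theorem IsFiberDense.sup_closure {α : Cardinal.{u}} {A N : AddSubgroup G}
    (h : IsFiberDense α (A : Set G) (N : Set G)) :
    IsFiberDense α
      ((A ⊔ AddSubgroup.closure (range (Quotient.out : G ⧸ N → G)) : AddSubgroup G) : Set G)
      univ := by
  intro f hf x _
  let e : G := Quotient.out (x : G ⧸ N)
  have he : -e + x ∈ N := QuotientAddGroup.eq.1 (Quotient.out_eq' (x : G ⧸ N))
  obtain ⟨a, ha, -, hax⟩ := h (fun y => f (e + y)) (by fun_prop) _ he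
  refine ⟨e + a, add_mem ?_ ?_, mem_univ _, by simpa using hax⟩
  · exact AddSubgroup.mem_sup_right (AddSubgroup.subset_closure ⟨_, rfl⟩)
  · exact AddSubgroup.mem_sup_left ha

/-- Otherwise there are nested cosets of fibre subgroups, the (n+1)-st missing A n. Compactness of
the image of one map into ℝ^α gives them a common point, which lies in no A n. -/
theorem IsAlphaPseudocompact.exists_isFiberDense {α : Cardinal.{u}} (hα : ℵ₀ ≤ α)
    (hG : IsAlphaPseudocompact α G) (A : ℕ → AddSubgroup G) (hA : ∀ x, ∃ n, x ∈ A n) :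
    ∃ n, ∃ N : AddSubgroup G, IsFiberSubgroup α N ∧ IsFiberDense α (A n : Set G) (N : Set G) := by
  by_contra! hcon
  have step : ∀ n (p : G × {N : AddSubgroup G // IsFiberSubgroup α N}),
      ∃ q : G × {N : AddSubgroup G // IsFiberSubgroup α N}, q.2.1 ≤ p.2.1 ∧ q.1 - p.1 ∈ p.2.1 ∧
        ∀ a, a - q.1 ∈ q.2.1 → a ∉ A n := by
    rintro n ⟨y, N, hN⟩
    by_cases hne : ∃ b ∈ A n, b - y ∈ N
    · obtain ⟨b, hbA, hbN⟩ := hne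
      have := hcon n N hN
      simp only [IsFiberDense, not_forall, not_exists, not_and] at this
      obtain ⟨f, hf, x, hx, hxf⟩ := this
      obtain ⟨M, hM, hMf⟩ := exists_isFiberSubgroup_forall_eq hα
        (f := fun z => f (x + z)) (by fun_prop)
      -- Translation by b ∈ A n carries the fibre in N that misses A n into the current coset.
      refine ⟨⟨b + x, M ⊓ N, hM.inf hα hN⟩, inf_le_right, ?_, fun a ha haA => ?_⟩
      · have := N.add_mem hbN hx
        have e : b - y + x = b + x - y := by abel
        simpa [e] using this
      · refine hxf (a - b) ((A n).sub_mem haA hbA) ?_ ?_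
        · have := N.add_mem ha.2 hx
          have e : a - (b + x) + x = a - b := by abel
          simpa [e] using this
        · have := hMf _ ha.1
          have e : x + (a - (b + x)) = a - b := by abel
          simpa [e] using this
    · push Not at hne
      exact ⟨⟨y, N, hN⟩, le_rfl, by simp, fun a ha haA => hne a haA ha⟩
  choose g hgle hgmem hgA using step
  have htop : IsFiberSubgroup α (⊤ : AddSubgroup G) := ⟨fun _ => 0, continuous_const, by simp⟩
  let s : ℕ → G × {N : AddSubgroup G // IsFiberSubgroup α N} :=
    fun n => Nat.rec ⟨0, ⊤, htop⟩ g n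
  have hanti : Antitone fun n => (s n).2.1 := antitone_nat_of_succ_le fun n => hgle n (s n)
  have hmem : ∀ m n, m ≤ n → (s n).1 - (s m).1 ∈ (s m).2.1 := fun m n hmn => by
    induction n, hmn using Nat.le_induction with
    | base => simp
    | succ n hmn ih =>
      have := add_mem (hanti hmn (hgmem n (s n))) ih
      simpa using this
  choose f hf hfN using fun n => (s n).2.2
  have hne : Nonempty α.out := by
    rw [← mk_ne_zero_iff, mk_out]
    exact (aleph0_pos.trans_le hα).ne'
  have hcard : #(α.out × ℕ) = #α.out := by simp [mul_aleph0_eq hα]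
  obtain ⟨ψ⟩ := Cardinal.eq.1 hcard
  -- F packs all the maps defining the cosets, so membership in the m-th coset is a closed condition
  -- on F x.
  let F : G → α.out → ℝ := fun x a => f (ψ.symm a).2 (x - (s (ψ.symm a).2).1) (ψ.symm a).1
  have hF : Continuous F := continuous_pi fun a =>
    (continuous_apply _).comp ((hf _).comp (by fun_prop))
  obtain ⟨z, hz⟩ : (⋂ n, range F ∩
      {p | ∀ m ≤ n, ∀ a, p (ψ (a, m)) = f m 0 a}).Nonempty := by
    have hcl : ∀ n : ℕ, IsClosed {p : α.out → ℝ | ∀ m ≤ n, ∀ a, p (ψ (a, m)) = f m 0 a} := by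
      intro n
      simp only [ofPred_forall]
      exact isClosed_iInter fun m => isClosed_iInter fun _ => isClosed_iInter fun a =>
        isClosed_eq (continuous_apply _) continuous_const
    refine IsCompact.nonempty_iInter_of_sequence_nonempty_isCompact_isClosed _ ?_ ?_ ?_ ?_
    · exact fun n => inter_subset_inter_right _ fun p hp m hm => hp m (hm.trans n.le_succ)
    · intro n
      refine ⟨F (s n).1, ⟨_, rfl⟩, fun m hm a => ?_⟩
      simp only [F, Equiv.symm_apply_apply]
      exact congrFun ((hfN m _).1 (hmem m n hm)) a
    · exact (hG F hF).inter_right (hcl 0)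
    · exact fun n => (hG F hF).isClosed.inter (hcl n)
  simp only [mem_iInter] at hz
  obtain ⟨x, rfl⟩ := (hz 0).1
  obtain ⟨n, hn⟩ := hA x
  refine hgA n (s n) x ?_ hn
  refine (hfN (n + 1) _).2 (funext fun a => ?_)
  simpa [F] using (hz (n + 1)).2 (n + 1) le_rfl a

end

/-! ### Free rank of quotients -/

theorem exists_seq_addSubgroup_rank_le_rank_quotient {G : Type u} [AddCommGroup G]
    (h : ℵ₀ ≤ Module.rank ℤ G) :
    ∃ A : ℕ → AddSubgroup G, (∀ x, ∃ n, x ∈ A n) ∧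
      ∀ n, Module.rank ℤ G ≤ Module.rank ℤ (G ⧸ A n) := by
  obtain ⟨I, hI, hmax⟩ := exists_maximal_linearIndepOn ℤ (id : G → G)
  simp only [id, image_id'] at hmax
  have hrank : Module.rank ℤ G = #I := by
    have h0 : Module.rank ℤ (G ⧸ Submodule.span ℤ I) = 0 := by
      rw [rank_eq_zero_iff]
      intro q
      obtain ⟨x, rfl⟩ := Submodule.Quotient.mk_surjective _ q
      by_cases hx : x ∈ I
      · exact ⟨1, one_ne_zero, by
          rw [one_smul]
          exact (Submodule.Quotient.mk_eq_zero _).2 (Submodule.subset_span hx)⟩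
      · obtain ⟨a, ha, hax⟩ := hmax x hx
        exact ⟨a, ha, by
          rw [← Submodule.Quotient.mk_smul]
          exact (Submodule.Quotient.mk_eq_zero _).2 hax⟩
    rw [← Submodule.rank_quotient_add_rank (Submodule.span ℤ I), h0, zero_add]
    exact rank_span_set hI
  rw [hrank] at h ⊢
  have hcard : #(I × ℕ) = #I := by simp [mul_aleph0_eq h]
  obtain ⟨ψ⟩ := Cardinal.eq.1 hcard
  let b : I × ℕ → G := fun p => ψ p
  have hb : LinearIndependent ℤ b :=
    LinearIndependent.comp (v := fun i : I => (i : G)) hI ψ ψ.injective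
  have hbI : range b = I := by
    rw [show b = Subtype.val ∘ ψ from rfl, range_comp, ψ.surjective.range_eq, image_univ,
      Subtype.range_coe]
  let S : ℕ → Set (I × ℕ) := fun n => {p | p.2 ≤ n}
  -- The pure closure is needed: the spans alone exhaust only the span of I, over which G is
  -- torsion. Block n + 1 stays independent modulo A n.
  let A : ℕ → AddSubgroup G := fun n =>
    { carrier := {x | ∃ m : ℤ, m ≠ 0 ∧ m • x ∈ Submodule.span ℤ (b '' S n)}
      zero_mem' := ⟨1, one_ne_zero, by simp⟩
      neg_mem' := fun {x} ⟨m, hm, hx⟩ => ⟨m, hm, by simpa using hx⟩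
      add_mem' := fun {x y} ⟨m, hm, hx⟩ ⟨k, hk, hy⟩ => ⟨m * k, mul_ne_zero hm hk, by
        rw [smul_add]
        refine add_mem ?_ ?_
        · rw [mul_comm, mul_smul]
          exact Submodule.smul_mem _ _ hx
        · rw [mul_smul]
          exact Submodule.smul_mem _ _ hy⟩ }
  refine ⟨A, fun x => ?_, fun n => ?_⟩
  · obtain ⟨a, ha, hax⟩ : ∃ a : ℤ, a ≠ 0 ∧ a • x ∈ Submodule.span ℤ I := by
      by_cases hx : x ∈ I
      · exact ⟨1, one_ne_zero, by simpa using Submodule.subset_span hx⟩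
      · exact hmax x hx
    rw [← hbI, Finsupp.mem_span_range_iff_exists_finsupp] at hax
    obtain ⟨c, hc⟩ := hax
    refine ⟨c.support.sup Prod.snd, a, ha, ?_⟩
    rw [← hc]
    refine Submodule.sum_mem _ fun p hp => Submodule.smul_mem _ _ (Submodule.subset_span ?_)
    exact ⟨p, Finset.le_sup (f := Prod.snd) hp, rfl⟩
  · have hli : LinearIndependent ℤ fun i : I => (b (i, n + 1) : G ⧸ A n) := by
      rw [linearIndependent_iff']
      intro t c hc i hi
      have hmem : ∑ j ∈ t, c j • b (j, n + 1) ∈ A n := by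
        rw [← QuotientAddGroup.eq_zero_iff, ← hc]
        simp
      obtain ⟨m, hm, hmem⟩ := hmem
      have hdis := hb.disjoint_span_image (s := S n) (t := (S n)ᶜ) disjoint_compl_right
      have h0 := Submodule.disjoint_def.1 hdis _ hmem (by
        refine Submodule.smul_mem _ _ (Submodule.sum_mem _ fun j _ =>
          Submodule.smul_mem _ _ (Submodule.subset_span ⟨(j, n + 1), ?_, rfl⟩))
        simp [S])
      have hli : LinearIndependent ℤ fun i : I => b (i, n + 1) :=
        hb.comp (fun i : I => (i, n + 1)) fun i j hij => (Prod.ext_iff.1 hij).1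
      rw [Finset.smul_sum] at h0
      simp only [← mul_smul] at h0
      exact (mul_eq_zero.1 (linearIndependent_iff'.1 hli t (fun j => m * c j) h0 i hi)).resolve_left
        hm
    exact hli.cardinal_le_rank

/-- The kernel of the projection between the two quotients is spanned by the image of E. -/
theorem rank_quotient_le_rank_quotient_sup_closure_add {G : Type u} [AddCommGroup G]
    (A : AddSubgroup G) (E : Set G) :
    Module.rank ℤ (G ⧸ A) ≤ Module.rank ℤ (G ⧸ (A ⊔ AddSubgroup.closure E)) + #E := by
  let φ : (G ⧸ A) →+ (G ⧸ (A ⊔ AddSubgroup.closure E)) :=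
    QuotientAddGroup.map _ _ (AddMonoidHom.id G) le_sup_left
  have h := φ.toIntLinearMap.rank_range_add_rank_ker
  rw [← h]
  refine add_le_add (Submodule.rank_le _) ?_
  have hker : LinearMap.ker φ.toIntLinearMap =
      Submodule.span ℤ ((QuotientAddGroup.mk : G → G ⧸ A) '' E) := by
    refine le_antisymm ?_ (Submodule.span_le.2 ?_)
    · intro q hq
      obtain ⟨x, rfl⟩ := QuotientAddGroup.mk_surjective q
      have hx : x ∈ A ⊔ AddSubgroup.closure E := (QuotientAddGroup.eq_zero_iff x).1 hq
      obtain ⟨a, ha, e, he, rfl⟩ := AddSubgroup.mem_sup.1 hx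
      have : ((a + e : G) : G ⧸ A) = e := by
        simp [(QuotientAddGroup.eq_zero_iff a).2 ha]
      rw [this]
      clear hq hx this
      induction he using AddSubgroup.closure_induction with
      | mem x hx => exact Submodule.subset_span ⟨x, hx, rfl⟩
      | zero => exact zero_mem _
      | add x y _ _ hx hy => exact add_mem hx hy
      | neg x _ hx => exact neg_mem hx
    · rintro _ ⟨x, hx, rfl⟩
      exact (QuotientAddGroup.eq_zero_iff x).2
        (AddSubgroup.mem_sup_right (AddSubgroup.subset_closure hx))
  rw [hker]
  exact (rank_span_le _).trans mk_image_le

theorem mainTheorem6 (α : Cardinal.{u}) (hα : Cardinal.aleph0 ≤ α)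
    (G : Type u) [AddCommGroup G] [TopologicalSpace G] [IsTopologicalAddGroup G] [T2Space G]
    (hG : IsAlphaPseudocompact α G) (hc : IsCExtremal α G) :
    freeRank G ≤ 2 ^ α := by
  by_contra! hlt
  have hinf : ℵ₀ ≤ (2 : Cardinal.{u}) ^ α := hα.trans (cantor α).le
  obtain ⟨A, hA, hrank⟩ := exists_seq_addSubgroup_rank_le_rank_quotient (hinf.trans hlt.le)
  obtain ⟨n, N, hN, hAN⟩ := hG.exists_isFiberDense hα A hA
  have hD := hAN.sup_closure
  have hlt' := hc.freeRank_quotient_lt _ (fun x => mem_closure_iff_nhds.2 fun U hU => by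
      obtain ⟨d, hd, hdU⟩ := hD.exists_mem_nhds hα hU
      exact ⟨d, hdU, hd⟩) (hD.isAlphaPseudocompact hα hG)
  have hcard : #(range (Quotient.out : G ⧸ N → G)) ≤ 2 ^ α :=
    mk_range_le.trans (hN.mk_quotient_le hα fun U hU => hG.exists_finset_sub_mem hα hU)
  refine hlt.not_ge ((hrank n).trans ((rank_quotient_le_rank_quotient_sup_closure_add (A n)
    (range (Quotient.out : G ⧸ N → G))).trans ?_))
  exact (add_le_add hlt'.le hcard).trans (add_eq_self hinf).le
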